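/- Let $d\in\mathbb N$ and $a,b>0$. Let $\mathcal M(\mathbb R^d)$ be the set of positive Radon measures with finite mass on $\mathbb R^d$, and let $\mathcal M^s(\mathbb R^d)$ be the space of finite signed Radon measures, i.e. of differences $\mu_+-\mu_-$ with $\mu_+,\mu_-\in\mathcal M(\mathbb R^d)$. The mass of $\sigma\in\mathcal M^s(\mathbb R^d)$ with Jordan decomposition $\sigma=\sigma_+^J-\sigma_-^J$ is $|\sigma|=\sigma_+^J(\mathbb R^d)+\sigma_-^J(\mathbb R^d)$. For $\mu,\nu\in\mathcal M(\mathbb R^d)$ with $|\mu|=|\nu|$ let $$W_1(\mu,\nu)=\inf_{\pi\in\Pi(\mu,\nu)}\int_{\mathbb R^d\times\mathbb R^d}|x-y|\,d\pi(x,y)\in[0,\infty],$$ where $\Pi(\mu,\nu)$ is the set of positive Borel measures on $\mathbb R^d\times\mathbb R^d$ with marginals $\mu$ and $\nu$. For arbitrary $\mu,\nu\in\mathcal M(\mathbb R^d)$ let $$W_1^{a,b}(\mu,\nu)=\inf_{\tilde\mu,\tilde\nu\in\mathcal M(\mathbb R^d),\ |\tilde\mu|=|\tilde\nu|}\Big(a\big(|\mu-\tilde\mu|+|\nu-\tilde\nu|\big)+b\,W_1(\tilde\mu,\tilde\nu)\Big).$$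 For $\mu,\nu\in\mathcal M^s(\mathbb R^d)$ put $$\mathbb W_1^{a,b}(\mu,\nu)=W_1^{a,b}(\mu_++\nu_-,\ \mu_-+\nu_+),$$ where $\mu_\pm,\nu_\pm\in\mathcal M(\mathbb R^d)$ are any measures with $\mu=\mu_+-\mu_-$ and $\nu=\nu_+-\nu_-$. Then $\mathbb W_1^{a,b}(\mu,\nu)$ does not depend on the choice of these decompositions, and $\mathbb W_1^{a,b}$ is a distance on $\mathcal M^s(\mathbb R^d)$: for all $\mu,\nu,\eta\in\mathcal M^s(\mathbb R^d)$ it is finite and nonnegative, $\mathbb W_1^{a,b}(\mu,\nu)=0$ if and only if $\mu=\nu$, $\mathbb W_1^{a,b}(\mu,\nu)=\mathbb W_1^{a,b}(\nu,\mu)$, and $\mathbb W_1^{a,b}(\mu,\eta)\le\mathbb W_1^{a,b}(\mu,\nu)+\mathbb W_1^{a,b}(\nu,\eta)$. -/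

import Mathlib

open MeasureTheory
open scoped ENNReal

noncomputable section

namespace SignedWasserstein

/-- The Euclidean space `ℝ^d`. Finite Borel measures on it (`FiniteMeasure (Rd d)`) are exactly the
positive Radon measures with finite mass, and `SignedMeasure (Rd d)` is the space of differences
of two such measures. -/
abbrev Rd (d : ℕ) : Type := EuclideanSpace ℝ (Fin d)

/-- The transference plans between `μ` and `ν`: measures on the product with marginals `μ`, `ν`. -/
def transferencePlans {d : ℕ} (μ ν : FiniteMeasure (Rd d)) : Set (Measure (Rd d × Rd d)) :=
  {π | (∀ A : Set (Rd d), MeasurableSet A → π (A ×ˢ Set.univ) = (μ : Measure (Rd d)) A) ∧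
    (∀ B : Set (Rd d), MeasurableSet B → π (Set.univ ×ˢ B) = (ν : Measure (Rd d)) B)}

/-- The `1`-Wasserstein distance between two measures (of the same mass), with values in `[0, ∞]`;
it is `∞` when every transference plan has infinite cost. -/
def W₁ {d : ℕ} (μ ν : FiniteMeasure (Rd d)) : ℝ≥0∞ :=
  ⨅ π ∈ transferencePlans μ ν, ∫⁻ z, ENNReal.ofReal ‖z.1 - z.2‖ ∂π

/-- The signed measure `μ - ν`. -/
def diff {d : ℕ} (μ ν : FiniteMeasure (Rd d)) : SignedMeasure (Rd d) :=
  (μ : Measure (Rd d)).toSignedMeasure - (ν : Measure (Rd d)).toSignedMeasure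

/-- The mass `|σ| = |σ₊| + |σ₋|` of a signed measure, through its Jordan decomposition. -/
def signedMass {d : ℕ} (σ : SignedMeasure (Rd d)) : ℝ≥0∞ :=
  σ.totalVariation Set.univ

/-- The generalized Wasserstein distance `W₁^{a,b}` between two finite positive measures. -/
def genW {d : ℕ} (a b : ℝ) (μ ν : FiniteMeasure (Rd d)) : ℝ≥0∞ :=
  ⨅ (μ' : FiniteMeasure (Rd d)) (ν' : FiniteMeasure (Rd d)) (_ : μ'.mass = ν'.mass),
    ENNReal.ofReal a * (signedMass (diff μ μ') + signedMass (diff ν ν')) +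
      ENNReal.ofReal b * W₁ μ' ν'

/-- The positive part of the Jordan decomposition. -/
def jordanPos {d : ℕ} (σ : SignedMeasure (Rd d)) : FiniteMeasure (Rd d) :=
  ⟨σ.toJordanDecomposition.posPart, σ.toJordanDecomposition.posPart_finite⟩

/-- The negative part of the Jordan decomposition. -/
def jordanNeg {d : ℕ} (σ : SignedMeasure (Rd d)) : FiniteMeasure (Rd d) :=
  ⟨σ.toJordanDecomposition.negPart, σ.toJordanDecomposition.negPart_finite⟩

/-- The generalized Wasserstein distance `𝕎₁^{a,b}` between signed measures, computed with the
Jordan decompositions. That every other choice of decompositions gives the same value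
is a claim to be proved, not part of the definition. -/
def signedW {d : ℕ} (a b : ℝ) (μ ν : SignedMeasure (Rd d)) : ℝ≥0∞ :=
  genW a b (jordanPos μ + jordanNeg ν) (jordanNeg μ + jordanPos ν)

end SignedWasserstein

end

open ProbabilityTheory
open scoped NNReal

/-!
A transport plan has two marginals of equal mass, so the minimization over intermediate measures
and plans in `W₁^{a,b}` collapses to one over all finite plans, each of which pays `a` times the
total variation between its marginals and the prescribed measures. Add, scale, swap and glue plans
to get subadditivity, homogeneity, symmetry and the triangle inequality.

Subadditivity alone gives `W (μ + η) (ν + η) ≤ W μ ν`. Conversely, passing from `n • μ + η` to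
`n • ν + η` by exchanging one copy of `μ` for one of `ν` at a time costs at most
`n * W (μ + η) (ν + η)`, while by homogeneity `n * W μ ν = W (n • μ) (n • ν)` differs from the cost
of that passage by a constant; letting `n` grow gives equality. This translation invariance makes
the signed distance independent of the decompositions. Separation comes from testing against
bounded Lipschitz functions (weak Kantorovich duality).
-/

namespace SignedWasserstein

section TotalVariation

variable {X Y : Type*} [MeasurableSpace X] [MeasurableSpace Y]

/-- The total variation `|μ - ν|` of the difference of two positive measures, expressed by the
truncated differences of measures, which for finite measures are the Jordan parts of `μ - ν`. -/
noncomputable def tvDist (μ ν : Measure X) : ℝ≥0∞ :=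
  (μ - ν) Set.univ + (ν - μ) Set.univ

theorem tvDist_comm (μ ν : Measure X) : tvDist μ ν = tvDist ν μ := add_comm _ _

@[simp]
theorem tvDist_self (μ : Measure X) : tvDist μ μ = 0 := by simp [tvDist]

theorem tvDist_ne_top (μ ν : Measure X) [IsFiniteMeasure μ] [IsFiniteMeasure ν] :
    tvDist μ ν ≠ ∞ :=
  ENNReal.add_ne_top.2 ⟨measure_ne_top _ _, measure_ne_top _ _⟩

theorem tvDist_self_add (μ θ : Measure X) [IsFiniteMeasure μ] :
    tvDist μ (μ + θ) = θ Set.univ := by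
  rw [tvDist, Measure.sub_eq_zero_of_le (Measure.le_add_right le_rfl), add_comm μ θ,
    Measure.add_sub_cancel, Measure.coe_zero, Pi.zero_apply, zero_add]

theorem tvDist_le_of_le_add {μ ν θ₁ θ₂ : Measure X} (h₁ : μ ≤ θ₁ + ν) (h₂ : ν ≤ θ₂ + μ) :
    tvDist μ ν ≤ θ₁ Set.univ + θ₂ Set.univ :=
  add_le_add (Measure.sub_le_of_le_add h₁ _) (Measure.sub_le_of_le_add h₂ _)

theorem sub_add_eq_sub_add (μ ν : Measure X) [IsFiniteMeasure μ] [IsFiniteMeasure ν] :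
    (μ - ν) + ν = (ν - μ) + μ := by
  have h := Measure.sub_toSignedMeasure_eq_toSignedMeasure_sub (μ := μ) (ν := ν)
  rw [sub_eq_sub_iff_add_eq_add] at h
  rw [← Measure.toSignedMeasure_eq_toSignedMeasure_iff, Measure.toSignedMeasure_add,
    Measure.toSignedMeasure_add, ← h, add_comm]

theorem le_sub_add (μ ν : Measure X) [IsFiniteMeasure μ] [IsFiniteMeasure ν] :
    μ ≤ (μ - ν) + ν :=
  sub_add_eq_sub_add μ ν ▸ Measure.le_add_left le_rfl

theorem tvDist_triangle (μ ν η : Measure X) [IsFiniteMeasure μ] [IsFiniteMeasure ν]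
    [IsFiniteMeasure η] : tvDist μ η ≤ tvDist μ ν + tvDist ν η := by
  have le_sub_add_sub_add (μ₁ μ₂ μ₃ : Measure X) [IsFiniteMeasure μ₁] [IsFiniteMeasure μ₂]
      [IsFiniteMeasure μ₃] : μ₁ ≤ (μ₁ - μ₂) + (μ₂ - μ₃) + μ₃ := by
    rw [add_assoc]
    exact (le_sub_add μ₁ μ₂).trans (add_le_add le_rfl (le_sub_add μ₂ μ₃))
  refine (tvDist_le_of_le_add (le_sub_add_sub_add μ ν η) (le_sub_add_sub_add η ν μ)).trans_eq ?_
  simp only [tvDist, Measure.add_apply]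
  ring

theorem tvDist_add_le (μ₁ μ₂ ν₁ ν₂ : Measure X) [IsFiniteMeasure μ₁] [IsFiniteMeasure μ₂]
    [IsFiniteMeasure ν₁] [IsFiniteMeasure ν₂] :
    tvDist (μ₁ + μ₂) (ν₁ + ν₂) ≤ tvDist μ₁ ν₁ + tvDist μ₂ ν₂ := by
  have h₁ := add_le_add (le_sub_add μ₁ ν₁) (le_sub_add μ₂ ν₂)
  have h₂ := add_le_add (le_sub_add ν₁ μ₁) (le_sub_add ν₂ μ₂)
  rw [add_add_add_comm] at h₁ h₂
  refine (tvDist_le_of_le_add h₁ h₂).trans_eq ?_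
  simp only [tvDist, Measure.add_apply]
  ring

theorem tvDist_smul_le (c : ℝ≥0) (μ ν : Measure X) [IsFiniteMeasure μ] [IsFiniteMeasure ν] :
    tvDist (c • μ) (c • ν) ≤ c * tvDist μ ν := by
  have smul_le (μ₁ μ₂ : Measure X) [IsFiniteMeasure μ₁] [IsFiniteMeasure μ₂] :
      c • μ₁ ≤ c • (μ₁ - μ₂) + c • μ₂ := by
    rw [← smul_add]
    gcongr
    exact le_sub_add μ₁ μ₂
  refine (tvDist_le_of_le_add (smul_le μ ν) (smul_le ν μ)).trans_eq ?_
  rw [tvDist, mul_add]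
  rfl

theorem tvDist_comp_le (κ : Kernel X Y) [IsMarkovKernel κ] (μ ν : Measure X) [IsFiniteMeasure μ]
    [IsFiniteMeasure ν] : tvDist (κ ∘ₘ μ) (κ ∘ₘ ν) ≤ tvDist μ ν := by
  have comp_le (μ₁ μ₂ : Measure X) [IsFiniteMeasure μ₁] [IsFiniteMeasure μ₂] :
      κ ∘ₘ μ₁ ≤ κ ∘ₘ (μ₁ - μ₂) + κ ∘ₘ μ₂ := by
    rw [← Measure.comp_add]
    refine Measure.le_iff.2 fun s hs => ?_
    rw [Measure.bind_apply hs κ.aemeasurable, Measure.bind_apply hs κ.aemeasurable]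
    exact lintegral_mono' (le_sub_add μ₁ μ₂) le_rfl
  refine (tvDist_le_of_le_add (comp_le μ ν) (comp_le ν μ)).trans_eq ?_
  rw [Measure.comp_apply_univ, Measure.comp_apply_univ, tvDist]

theorem exists_le_tvDist_add_tvDist_eq (μ ν : Measure X) [IsFiniteMeasure μ]
    [IsFiniteMeasure ν] : ∃ ρ ≤ μ, ρ ≤ ν ∧ tvDist μ ρ + tvDist ν ρ = tvDist μ ν := by
  -- The witness is `μ ⊓ ν`, in the form `μ - (μ - ν)`.
  set ρ := μ - (μ - ν)
  have hμ : ρ + (μ - ν) = μ := Measure.sub_add_cancel_of_le Measure.sub_le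
  have hν : ρ + (ν - μ) = ν := by
    have h : (ρ + (ν - μ)) + (μ - ν) = ν + (μ - ν) := by
      rw [add_right_comm, hμ, add_comm, ← sub_add_eq_sub_add, add_comm]
    rw [← Measure.toSignedMeasure_eq_toSignedMeasure_iff] at h ⊢
    rw [Measure.toSignedMeasure_add _ (μ - ν), Measure.toSignedMeasure_add ν] at h
    exact add_right_cancel h
  have hμρ : tvDist μ ρ = (μ - ν) Set.univ := by
    rw [← tvDist_self_add ρ (μ - ν), hμ, tvDist_comm]
  have hνρ : tvDist ν ρ = (ν - μ) Set.univ := by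
    rw [← tvDist_self_add ρ (ν - μ), hν, tvDist_comm]
  exact ⟨ρ, Measure.sub_le, hν ▸ Measure.le_add_right le_rfl, by rw [hμρ, hνρ, tvDist]⟩

theorem lintegral_le_add_mul_tvDist {f : X → ℝ≥0∞} {M : ℝ≥0∞} (hf : ∀ x, f x ≤ M)
    (μ ν : Measure X) [IsFiniteMeasure μ] [IsFiniteMeasure ν] :
    ∫⁻ x, f x ∂μ ≤ ∫⁻ x, f x ∂ν + M * tvDist μ ν := by
  calc ∫⁻ x, f x ∂μ ≤ ∫⁻ x, f x ∂((μ - ν) + ν) := lintegral_mono' (le_sub_add μ ν) le_rfl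
    _ = ∫⁻ x, f x ∂ν + ∫⁻ x, f x ∂(μ - ν) := by rw [lintegral_add_measure, add_comm]
    _ ≤ ∫⁻ x, f x ∂ν + M * (μ - ν) Set.univ := by
        gcongr
        exact (lintegral_mono hf).trans_eq (lintegral_const M)
    _ ≤ ∫⁻ x, f x ∂ν + M * tvDist μ ν := by
        gcongr
        exact le_self_add

end TotalVariation

section TransportCost

variable {X : Type*} [MeasurableSpace X] [PseudoEMetricSpace X]

/-- The cost of the transport plan `π` for the distance cost function. -/
noncomputable def transportCost (π : Measure (X × X)) : ℝ≥0∞ :=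
  ∫⁻ z, edist z.1 z.2 ∂π

theorem transportCost_add (π₁ π₂ : Measure (X × X)) :
    transportCost (π₁ + π₂) = transportCost π₁ + transportCost π₂ :=
  lintegral_add_measure _ _ _

theorem transportCost_smul (c : ℝ≥0) (π : Measure (X × X)) :
    transportCost (c • π) = c * transportCost π :=
  lintegral_smul_measure _ _

variable [OpensMeasurableSpace X] [SecondCountableTopology X]

theorem transportCost_map_swap (π : Measure (X × X)) :
    transportCost (π.map Prod.swap) = transportCost π := by
  simp only [transportCost, lintegral_map measurable_edist measurable_swap, Prod.fst_swap,
    Prod.snd_swap, edist_comm]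

theorem transportCost_map_diag (μ : Measure X) :
    transportCost (μ.map fun x => (x, x)) = 0 := by
  rw [transportCost, lintegral_map measurable_edist (by fun_prop)]
  simp only [edist_self, lintegral_zero]

theorem transportCost_compProd (ρ : Measure X) [SFinite ρ] (κ : Kernel X X) [IsSFiniteKernel κ] :
    transportCost (ρ ⊗ₘ κ) = ∫⁻ y, ∫⁻ x, edist y x ∂κ y ∂ρ :=
  Measure.lintegral_compProd measurable_edist

theorem transportCost_comp_prod_le (ρ : Measure X) [SFinite ρ] (κ η : Kernel X X)
    [IsMarkovKernel κ] [IsMarkovKernel η] :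
    transportCost ((κ ×ₖ η) ∘ₘ ρ) ≤ transportCost (ρ ⊗ₘ κ) + transportCost (ρ ⊗ₘ η) := by
  have through (y : X) : ∫⁻ z, edist z.1 z.2 ∂(κ ×ₖ η) y ≤
      ∫⁻ x, edist y x ∂κ y + ∫⁻ x, edist y x ∂η y := by
    calc ∫⁻ z, edist z.1 z.2 ∂(κ ×ₖ η) y
        ≤ ∫⁻ z, (edist y z.1 + edist y z.2) ∂((κ y).prod (η y)) := by
          rw [Kernel.prod_apply]
          exact lintegral_mono fun z => edist_triangle_left _ _ _
      _ = ∫⁻ z, edist y z.1 ∂((κ y).prod (η y)) + ∫⁻ z, edist y z.2 ∂((κ y).prod (η y)) :=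
          lintegral_add_left (by fun_prop) _
      _ = ∫⁻ x, edist y x ∂κ y + ∫⁻ x, edist y x ∂η y := by
          rw [lintegral_prod _ (by fun_prop), lintegral_prod _ (by fun_prop)]
          simp only [lintegral_const, measure_univ, mul_one]
  rw [transportCost, Measure.lintegral_bind (Kernel.aemeasurable _) measurable_edist.aemeasurable,
    transportCost_compProd, transportCost_compProd,
    ← lintegral_add_left (Measurable.lintegral_kernel_prod_right' measurable_edist)]
  exact lintegral_mono through

theorem lintegral_fst_le_add_mul_transportCost {f : X → ℝ≥0∞} (hf : Measurable f) {K : ℝ≥0∞}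
    (hK : ∀ x y, f x ≤ f y + K * edist x y) (π : Measure (X × X)) :
    ∫⁻ x, f x ∂π.fst ≤ ∫⁻ x, f x ∂π.snd + K * transportCost π := by
  calc ∫⁻ x, f x ∂π.fst = ∫⁻ z, f z.1 ∂π := lintegral_map hf measurable_fst
    _ ≤ ∫⁻ z, (f z.2 + K * edist z.1 z.2) ∂π := lintegral_mono fun z => hK z.1 z.2
    _ = ∫⁻ x, f x ∂π.snd + K * transportCost π := by
        rw [lintegral_add_left (by fun_prop), lintegral_const_mul _ measurable_edist,
          Measure.snd, lintegral_map hf measurable_snd, transportCost]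

end TransportCost

section Gluing

theorem fst_comp_prod {X Y Z : Type*} [MeasurableSpace X] [MeasurableSpace Y] [MeasurableSpace Z]
    (ρ : Measure X) (κ : Kernel X Y) [IsSFiniteKernel κ] (η : Kernel X Z) [IsMarkovKernel η] :
    ((κ ×ₖ η) ∘ₘ ρ).fst = κ ∘ₘ ρ := by
  rw [Measure.fst, Measure.map_comp _ _ measurable_fst, ← Kernel.fst_eq, Kernel.fst_prod]

theorem snd_comp_prod {X Y Z : Type*} [MeasurableSpace X] [MeasurableSpace Y] [MeasurableSpace Z]
    (ρ : Measure X) (κ : Kernel X Y) [IsMarkovKernel κ] (η : Kernel X Z) [IsSFiniteKernel η] :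
    ((κ ×ₖ η) ∘ₘ ρ).snd = η ∘ₘ ρ := by
  rw [Measure.snd, Measure.map_comp _ _ measurable_snd, ← Kernel.snd_eq, Kernel.snd_prod]

theorem condKernel_comp_fst {X Y : Type*} [MeasurableSpace X] [MeasurableSpace Y]
    [StandardBorelSpace Y] [Nonempty Y] (π : Measure (X × Y)) [IsFiniteMeasure π] :
    π.condKernel ∘ₘ π.fst = π.snd := by
  rw [← Measure.snd_compProd, π.disintegrate π.condKernel]

variable {X : Type*} [MeasurableSpace X] [PseudoEMetricSpace X] [OpensMeasurableSpace X]
  [SecondCountableTopology X] [StandardBorelSpace X] [Nonempty X]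

theorem transportCost_compProd_condKernel_le (π : Measure (X × X)) [IsFiniteMeasure π]
    {ρ : Measure X} [SFinite ρ] (hρ : ρ ≤ π.fst) :
    transportCost (ρ ⊗ₘ π.condKernel) ≤ transportCost π := by
  calc transportCost (ρ ⊗ₘ π.condKernel)
      ≤ transportCost (π.fst ⊗ₘ π.condKernel) := by
        rw [transportCost_compProd, transportCost_compProd]
        exact lintegral_mono' hρ le_rfl
    _ = transportCost π := by rw [π.disintegrate π.condKernel]

/-- The plans are glued along the common part of their first marginals; the mass outside the common
part is discarded. -/
theorem exists_glued_plan (π₁ π₂ : Measure (X × X)) [IsFiniteMeasure π₁] [IsFiniteMeasure π₂] :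
    ∃ π : Measure (X × X), IsFiniteMeasure π ∧
      tvDist π₁.snd π.fst + tvDist π₂.snd π.snd ≤ tvDist π₁.fst π₂.fst ∧
      transportCost π ≤ transportCost π₁ + transportCost π₂ := by
  obtain ⟨ρ, hρ₁, hρ₂, hρ⟩ := exists_le_tvDist_add_tvDist_eq π₁.fst π₂.fst
  have : IsFiniteMeasure ρ := isFiniteMeasure_of_le π₁.fst hρ₁
  refine ⟨(π₁.condKernel ×ₖ π₂.condKernel) ∘ₘ ρ, inferInstance, ?_, ?_⟩
  · rw [fst_comp_prod, snd_comp_prod, ← hρ, ← condKernel_comp_fst π₁, ← condKernel_comp_fst π₂]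
    exact add_le_add (tvDist_comp_le _ _ _) (tvDist_comp_le _ _ _)
  · exact (transportCost_comp_prod_le ρ _ _).trans (add_le_add
      (transportCost_compProd_condKernel_le π₁ hρ₁) (transportCost_compProd_condKernel_le π₂ hρ₂))

end Gluing

section RelaxedCost

variable {X : Type*} [MeasurableSpace X] [PseudoEMetricSpace X] {α β : ℝ≥0}

/-- The cost of transporting `μ` to `ν` along a plan `π` whose marginals need not be `μ` and `ν`:
the mismatch of the marginals is paid for at rate `α`, the transport at rate `β`. -/
noncomputable def relaxedCost (α β : ℝ≥0) (μ ν : Measure X) (π : Measure (X × X)) : ℝ≥0∞ :=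
  α * (tvDist μ π.fst + tvDist ν π.snd) + β * transportCost π

theorem relaxedCost_add_le (μ₁ μ₂ ν₁ ν₂ : Measure X) (π₁ π₂ : Measure (X × X))
    [IsFiniteMeasure μ₁] [IsFiniteMeasure μ₂] [IsFiniteMeasure ν₁] [IsFiniteMeasure ν₂]
    [IsFiniteMeasure π₁] [IsFiniteMeasure π₂] :
    relaxedCost α β (μ₁ + μ₂) (ν₁ + ν₂) (π₁ + π₂) ≤
      relaxedCost α β μ₁ ν₁ π₁ + relaxedCost α β μ₂ ν₂ π₂ := by
  calc relaxedCost α β (μ₁ + μ₂) (ν₁ + ν₂) (π₁ + π₂)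
      ≤ α * ((tvDist μ₁ π₁.fst + tvDist μ₂ π₂.fst) + (tvDist ν₁ π₁.snd + tvDist ν₂ π₂.snd)) +
          β * (transportCost π₁ + transportCost π₂) := by
        rw [relaxedCost, Measure.fst_add, Measure.snd_add, transportCost_add]
        gcongr <;> exact tvDist_add_le _ _ _ _
    _ = relaxedCost α β μ₁ ν₁ π₁ + relaxedCost α β μ₂ ν₂ π₂ := by
        rw [relaxedCost, relaxedCost]
        ring

theorem relaxedCost_smul_le (c : ℝ≥0) (μ ν : Measure X) (π : Measure (X × X))
    [IsFiniteMeasure μ] [IsFiniteMeasure ν] [IsFiniteMeasure π] :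
    relaxedCost α β (c • μ) (c • ν) (c • π) ≤ c * relaxedCost α β μ ν π := by
  have hfst : (c • π).fst = c • π.fst := Measure.map_smul _ _ _
  have hsnd : (c • π).snd = c • π.snd := Measure.map_smul _ _ _
  calc relaxedCost α β (c • μ) (c • ν) (c • π)
      ≤ α * (c * tvDist μ π.fst + c * tvDist ν π.snd) + β * (c * transportCost π) := by
        rw [relaxedCost, hfst, hsnd, transportCost_smul]
        gcongr <;> exact tvDist_smul_le _ _ _
    _ = c * relaxedCost α β μ ν π := by
        rw [relaxedCost]
        ring

variable [OpensMeasurableSpace X] [SecondCountableTopology X]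

theorem relaxedCost_map_swap (μ ν : Measure X) (π : Measure (X × X)) :
    relaxedCost α β μ ν (π.map Prod.swap) = relaxedCost α β ν μ π := by
  rw [relaxedCost, relaxedCost, Measure.fst_map_swap, Measure.snd_map_swap, transportCost_map_swap,
    add_comm (tvDist _ _)]

theorem relaxedCost_map_diag (μ ν : Measure X) :
    relaxedCost α β μ ν (ν.map fun x => (x, x)) = α * tvDist μ ν := by
  have hdiag : Measurable fun x : X => (x, x) := by fun_prop
  rw [relaxedCost, transportCost_map_diag, Measure.fst, Measure.snd,
    Measure.map_map measurable_fst hdiag, Measure.map_map measurable_snd hdiag]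
  simp [Function.comp_def]

theorem lintegral_le_add_relaxedCost {f : X → ℝ≥0∞} (hf : Measurable f) (hα : ∀ x, f x ≤ α)
    (hβ : ∀ x y, f x ≤ f y + β * edist x y) (μ ν : Measure X) (π : Measure (X × X))
    [IsFiniteMeasure μ] [IsFiniteMeasure ν] [IsFiniteMeasure π] :
    ∫⁻ x, f x ∂μ ≤ ∫⁻ x, f x ∂ν + relaxedCost α β μ ν π := by
  calc ∫⁻ x, f x ∂μ
      ≤ ∫⁻ x, f x ∂π.fst + α * tvDist μ π.fst := lintegral_le_add_mul_tvDist hα _ _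
    _ ≤ (∫⁻ x, f x ∂π.snd + β * transportCost π) + α * tvDist μ π.fst := by
        gcongr
        exact lintegral_fst_le_add_mul_transportCost hf hβ π
    _ ≤ ((∫⁻ x, f x ∂ν + α * tvDist π.snd ν) + β * transportCost π) + α * tvDist μ π.fst := by
        gcongr
        exact lintegral_le_add_mul_tvDist hα _ _
    _ = ∫⁻ x, f x ∂ν + relaxedCost α β μ ν π := by
        rw [relaxedCost, tvDist_comm π.snd]
        ring

theorem exists_relaxedCost_le_add [StandardBorelSpace X] [Nonempty X] (μ ν η : Measure X)
    (π₁ π₂ : Measure (X × X)) [IsFiniteMeasure μ] [IsFiniteMeasure ν] [IsFiniteMeasure η]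
    [IsFiniteMeasure π₁] [IsFiniteMeasure π₂] :
    ∃ π : Measure (X × X), IsFiniteMeasure π ∧
      relaxedCost α β μ η π ≤ relaxedCost α β ν μ π₁ + relaxedCost α β ν η π₂ := by
  obtain ⟨π, hπ, htv, hcost⟩ := exists_glued_plan π₁ π₂
  refine ⟨π, hπ, ?_⟩
  have hμη : tvDist μ π.fst + tvDist η π.snd ≤
      (tvDist ν π₁.fst + tvDist μ π₁.snd) + (tvDist ν π₂.fst + tvDist η π₂.snd) := by
    calc tvDist μ π.fst + tvDist η π.snd
        ≤ (tvDist μ π₁.snd + tvDist π₁.snd π.fst) + (tvDist η π₂.snd + tvDist π₂.snd π.snd) :=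
          add_le_add (tvDist_triangle _ _ _) (tvDist_triangle _ _ _)
      _ = (tvDist π₁.snd π.fst + tvDist π₂.snd π.snd) + (tvDist μ π₁.snd + tvDist η π₂.snd) := by
          ring
      _ ≤ (tvDist π₁.fst ν + tvDist ν π₂.fst) + (tvDist μ π₁.snd + tvDist η π₂.snd) :=
          add_le_add (htv.trans (tvDist_triangle _ _ _)) le_rfl
      _ = (tvDist ν π₁.fst + tvDist μ π₁.snd) + (tvDist ν π₂.fst + tvDist η π₂.snd) := by
          rw [tvDist_comm π₁.fst]
          ring
  calc relaxedCost α β μ η π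
      ≤ α * ((tvDist ν π₁.fst + tvDist μ π₁.snd) + (tvDist ν π₂.fst + tvDist η π₂.snd)) +
          β * (transportCost π₁ + transportCost π₂) := by
        rw [relaxedCost]
        gcongr
    _ = relaxedCost α β ν μ π₁ + relaxedCost α β ν η π₂ := by
        rw [relaxedCost, relaxedCost]
        ring

end RelaxedCost

theorem le_of_forall_nat_mul_le_add {x y C : ℝ≥0∞} (hC : C ≠ ∞)
    (h : ∀ n : ℕ, n * x ≤ n * y + C) : x ≤ y := by
  by_contra! hyx
  obtain ⟨n, hn⟩ := ENNReal.exists_nat_mul_gt (tsub_pos_of_lt hyx).ne' hC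
  rw [ENNReal.mul_sub fun _ _ => ENNReal.natCast_ne_top n] at hn
  exact hn.not_ge (tsub_le_iff_left.2 (h n))

section RelaxedW

variable {X : Type*} [MeasurableSpace X] [PseudoEMetricSpace X] {α β : ℝ≥0}

/-- The generalized Wasserstein distance on an arbitrary space, as an infimum over all finite plans.
The intermediate measures of the usual definition are the marginals of the plan. -/
noncomputable def relaxedW (α β : ℝ≥0) (μ ν : Measure X) : ℝ≥0∞ :=
  ⨅ π : FiniteMeasure (X × X), relaxedCost α β μ ν (π : Measure (X × X))

theorem relaxedW_le_relaxedCost (μ ν : Measure X) (π : Measure (X × X)) [hπ : IsFiniteMeasure π] :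
    relaxedW α β μ ν ≤ relaxedCost α β μ ν π :=
  iInf_le (fun π : FiniteMeasure (X × X) => relaxedCost α β μ ν (π : Measure (X × X))) ⟨π, hπ⟩

theorem relaxedW_add_le (μ₁ μ₂ ν₁ ν₂ : Measure X) [IsFiniteMeasure μ₁] [IsFiniteMeasure μ₂]
    [IsFiniteMeasure ν₁] [IsFiniteMeasure ν₂] :
    relaxedW α β (μ₁ + μ₂) (ν₁ + ν₂) ≤ relaxedW α β μ₁ ν₁ + relaxedW α β μ₂ ν₂ := by
  refine ENNReal.le_iInf_add_iInf fun π₁ π₂ => ?_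
  exact (relaxedW_le_relaxedCost _ _ ((π₁ : Measure (X × X)) + (π₂ : Measure (X × X)))).trans
    (relaxedCost_add_le μ₁ μ₂ ν₁ ν₂ π₁ π₂)

theorem relaxedW_smul_le (c : ℝ≥0) (μ ν : Measure X) [IsFiniteMeasure μ] [IsFiniteMeasure ν] :
    relaxedW α β (c • μ) (c • ν) ≤ c * relaxedW α β μ ν := by
  rw [relaxedW.eq_def α β μ, ENNReal.mul_iInf (by simp)]
  exact le_iInf fun π => (relaxedW_le_relaxedCost _ _ (c • (π : Measure (X × X)))).trans
    (relaxedCost_smul_le c μ ν π)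

theorem nat_mul_relaxedW_le_nsmul (n : ℕ) (μ ν : Measure X) [IsFiniteMeasure μ]
    [IsFiniteMeasure ν] : n * relaxedW α β μ ν ≤ relaxedW α β (n • μ) (n • ν) := by
  rcases eq_or_ne n 0 with rfl | hn
  · simp
  have inv_smul_nsmul (θ : Measure X) : (n : ℝ≥0)⁻¹ • n • θ = θ := by
    rw [← Nat.cast_smul_eq_nsmul ℝ≥0, smul_smul, inv_mul_cancel₀ (by exact_mod_cast hn), one_smul]
  calc n * relaxedW α β μ ν
      = n * relaxedW α β ((n : ℝ≥0)⁻¹ • n • μ) ((n : ℝ≥0)⁻¹ • n • ν) := by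
        rw [inv_smul_nsmul, inv_smul_nsmul]
    _ ≤ n * (((n : ℝ≥0)⁻¹ : ℝ≥0) * relaxedW α β (n • μ) (n • ν)) := by
        gcongr
        exact relaxedW_smul_le _ _ _
    _ = relaxedW α β (n • μ) (n • ν) := by
        rw [ENNReal.coe_inv (by exact_mod_cast hn), ENNReal.coe_natCast,
          ENNReal.mul_inv_cancel_left (by exact_mod_cast hn) (ENNReal.natCast_ne_top n)]

variable [OpensMeasurableSpace X] [SecondCountableTopology X]

theorem relaxedW_comm (μ ν : Measure X) : relaxedW α β μ ν = relaxedW α β ν μ := by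
  have le_swap (μ ν : Measure X) : relaxedW α β μ ν ≤ relaxedW α β ν μ :=
    le_iInf fun π => (relaxedW_le_relaxedCost μ ν ((π : Measure (X × X)).map Prod.swap)).trans_eq
      (relaxedCost_map_swap μ ν π)
  exact le_antisymm (le_swap μ ν) (le_swap ν μ)

theorem relaxedW_le_mul_tvDist (μ ν : Measure X) [IsFiniteMeasure ν] :
    relaxedW α β μ ν ≤ α * tvDist μ ν :=
  (relaxedW_le_relaxedCost μ ν (ν.map fun x => (x, x))).trans_eq (relaxedCost_map_diag μ ν)

theorem relaxedW_ne_top (μ ν : Measure X) [IsFiniteMeasure μ] [IsFiniteMeasure ν] :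
    relaxedW α β μ ν ≠ ∞ :=
  ne_top_of_le_ne_top (ENNReal.mul_ne_top ENNReal.coe_ne_top (tvDist_ne_top μ ν))
    (relaxedW_le_mul_tvDist μ ν)

@[simp]
theorem relaxedW_self (μ : Measure X) [IsFiniteMeasure μ] : relaxedW α β μ μ = 0 := by
  simpa using relaxedW_le_mul_tvDist (α := α) (β := β) μ μ

theorem relaxedW_self_add_le (μ η : Measure X) [IsFiniteMeasure μ] [IsFiniteMeasure η] :
    relaxedW α β μ (μ + η) ≤ α * η Set.univ :=
  (relaxedW_le_mul_tvDist _ _).trans_eq (by rw [tvDist_self_add])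

theorem relaxedW_add_right_le (μ ν η : Measure X) [IsFiniteMeasure μ] [IsFiniteMeasure ν]
    [IsFiniteMeasure η] : relaxedW α β (μ + η) (ν + η) ≤ relaxedW α β μ ν := by
  simpa using relaxedW_add_le (α := α) (β := β) μ η ν η

theorem lintegral_le_add_relaxedW {f : X → ℝ≥0∞} (hf : Measurable f) (hα : ∀ x, f x ≤ α)
    (hβ : ∀ x y, f x ≤ f y + β * edist x y) (μ ν : Measure X) [IsFiniteMeasure μ]
    [IsFiniteMeasure ν] : ∫⁻ x, f x ∂μ ≤ ∫⁻ x, f x ∂ν + relaxedW α β μ ν := by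
  rw [relaxedW, ENNReal.add_iInf]
  exact le_iInf fun π => lintegral_le_add_relaxedCost hf hα hβ μ ν π

section Triangle

variable [StandardBorelSpace X] [Nonempty X]

theorem relaxedW_triangle (μ ν η : Measure X) [IsFiniteMeasure μ] [IsFiniteMeasure ν]
    [IsFiniteMeasure η] : relaxedW α β μ η ≤ relaxedW α β μ ν + relaxedW α β ν η := by
  rw [relaxedW_comm μ ν]
  refine ENNReal.le_iInf_add_iInf fun π₁ π₂ => ?_
  obtain ⟨π, _, hπ⟩ := exists_relaxedCost_le_add (α := α) (β := β) μ ν η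
    (π₁ : Measure (X × X)) (π₂ : Measure (X × X))
  exact (relaxedW_le_relaxedCost μ η π).trans hπ

theorem relaxedW_nsmul_add_le (n : ℕ) (μ ν η : Measure X) [IsFiniteMeasure μ] [IsFiniteMeasure ν]
    [IsFiniteMeasure η] :
    relaxedW α β (n • μ + η) (n • ν + η) ≤ n * relaxedW α β (μ + η) (ν + η) := by
  induction n with
  | zero => simp
  | succ n ih =>
    calc relaxedW α β ((n + 1) • μ + η) ((n + 1) • ν + η)
        = relaxedW α β (μ + η + n • μ) (n • ν + η + ν) := by
          congr 1 <;> rw [succ_nsmul] <;> abel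
      _ ≤ relaxedW α β (μ + η + n • μ) (ν + η + n • μ) +
            relaxedW α β (ν + η + n • μ) (n • ν + η + ν) := relaxedW_triangle _ _ _
      _ = relaxedW α β (μ + η + n • μ) (ν + η + n • μ) +
            relaxedW α β (n • μ + η + ν) (n • ν + η + ν) := by
          congr 2
          abel
      _ ≤ relaxedW α β (μ + η) (ν + η) + n * relaxedW α β (μ + η) (ν + η) :=
          add_le_add (relaxedW_add_right_le _ _ _) ((relaxedW_add_right_le _ _ _).trans ih)
      _ = (n + 1 : ℕ) * relaxedW α β (μ + η) (ν + η) := by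
          push_cast
          ring

theorem relaxedW_add_right (μ ν η : Measure X) [IsFiniteMeasure μ] [IsFiniteMeasure ν]
    [IsFiniteMeasure η] : relaxedW α β (μ + η) (ν + η) = relaxedW α β μ ν := by
  have hC : (α * η Set.univ + α * η Set.univ : ℝ≥0∞) ≠ ∞ := by finiteness
  refine le_antisymm (relaxedW_add_right_le μ ν η) (le_of_forall_nat_mul_le_add hC fun n => ?_)
  calc n * relaxedW α β μ ν
      ≤ relaxedW α β (n • μ) (n • ν) := nat_mul_relaxedW_le_nsmul n μ ν
    _ ≤ relaxedW α β (n • μ) (n • μ + η) + (relaxedW α β (n • μ + η) (n • ν + η) +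
          relaxedW α β (n • ν + η) (n • ν)) :=
        (relaxedW_triangle _ _ _).trans (add_le_add le_rfl (relaxedW_triangle _ _ _))
    _ ≤ α * η Set.univ + (n * relaxedW α β (μ + η) (ν + η) + α * η Set.univ) := by
        rw [relaxedW_comm (n • ν + η)]
        gcongr
        · exact relaxedW_self_add_le _ _
        · exact relaxedW_nsmul_add_le n μ ν η
        · exact relaxedW_self_add_le _ _
    _ = n * relaxedW α β (μ + η) (ν + η) + (α * η Set.univ + α * η Set.univ) := by ring

end Triangle

end RelaxedW

section Separation

theorem coe_le_coe_add_mul_edist_of_lipschitzWith {X : Type*} [PseudoEMetricSpace X] {f : X → ℝ≥0}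
    {K : ℝ≥0} (hf : LipschitzWith K f) (x y : X) : (f x : ℝ≥0∞) ≤ f y + K * edist x y := by
  calc (f x : ℝ≥0∞) ≤ f y + edist (f x) (f y) := by
        rw [edist_nndist]
        exact_mod_cast NNReal.le_add_nndist (f x) (f y)
    _ ≤ f y + K * edist x y := by
        gcongr
        exact hf x y

variable {X : Type*} [MeasurableSpace X] [PseudoEMetricSpace X] [BorelSpace X] {α β : ℝ≥0}

theorem ext_of_forall_isClosed {μ ν : Measure X} [IsFiniteMeasure μ]
    (h : ∀ F : Set X, IsClosed F → μ F = ν F) : μ = ν :=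
  ext_of_generate_finite _ (BorelSpace.measurable_eq.trans borel_eq_generateFrom_isClosed)
    isPiSystem_isClosed h (h _ isClosed_univ)

variable [SecondCountableTopology X] {μ ν : Measure X} [IsFiniteMeasure μ] [IsFiniteMeasure ν]

theorem lintegral_le_of_relaxedW_eq_zero (hα : 0 < α) (hβ : 0 < β) (h : relaxedW α β μ ν = 0)
    {f : X → ℝ≥0} {K : ℝ≥0} (hf : LipschitzWith K f) (hf₁ : ∀ x, f x ≤ 1) :
    ∫⁻ x, f x ∂μ ≤ ∫⁻ x, f x ∂ν := by
  have hm : Measurable fun x => (f x : ℝ≥0∞) := hf.continuous.measurable.coe_nnreal_ennreal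
  -- Scaled by `t`, the function `f` is bounded by `α` and `β`-Lipschitz.
  obtain ⟨t, ht₀, htα, htβ⟩ : ∃ t : ℝ≥0, t ≠ 0 ∧ t ≤ α ∧ t * K ≤ β := by
    refine ⟨min α (β / (K + 1)), (lt_min hα (by positivity)).ne', min_le_left _ _, ?_⟩
    calc min α (β / (K + 1)) * K ≤ β / (K + 1) * (K + 1) :=
          mul_le_mul' (min_le_right _ _) le_self_add
      _ = β := div_mul_cancel₀ β (by positivity)
  have bounded (x : X) : (t * f x : ℝ≥0∞) ≤ α := by
    exact_mod_cast (mul_le_of_le_one_right' (hf₁ x)).trans htα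
  have lipschitz (x y : X) : (t * f x : ℝ≥0∞) ≤ t * f y + β * edist x y := by
    calc (t * f x : ℝ≥0∞) ≤ t * (f y + K * edist x y) := by
          gcongr
          exact coe_le_coe_add_mul_edist_of_lipschitzWith hf x y
      _ = t * f y + (t * K : ℝ≥0) * edist x y := by
          push_cast
          ring
      _ ≤ t * f y + β * edist x y := by gcongr
  have scaled := lintegral_le_add_relaxedW (hm.const_mul t) bounded lipschitz μ ν
  rw [h, add_zero, lintegral_const_mul _ hm, lintegral_const_mul _ hm] at scaled
  exact (ENNReal.mul_le_mul_iff_right (by simpa using ht₀) ENNReal.coe_ne_top).1 scaled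

theorem measure_le_of_relaxedW_eq_zero (hα : 0 < α) (hβ : 0 < β) (h : relaxedW α β μ ν = 0)
    {F : Set X} (hF : IsClosed F) : μ F ≤ ν F := by
  have hpos (n : ℕ) : (0 : ℝ) < 1 / ((n : ℝ) + 1) := by positivity
  have hlim := tendsto_one_div_add_atTop_nhds_zero_nat (𝕜 := ℝ)
  exact le_of_tendsto_of_tendsto' (tendsto_lintegral_thickenedIndicator_of_isClosed μ hF hpos hlim)
    (tendsto_lintegral_thickenedIndicator_of_isClosed ν hF hpos hlim) fun n =>
      lintegral_le_of_relaxedW_eq_zero hα hβ h (lipschitzWith_thickenedIndicator (hpos n) F)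
        (thickenedIndicator_le_one (hpos n) F)

theorem relaxedW_eq_zero_iff (hα : 0 < α) (hβ : 0 < β) : relaxedW α β μ ν = 0 ↔ μ = ν := by
  refine ⟨fun h => ext_of_forall_isClosed fun F hF => ?_, fun h => h ▸ relaxedW_self μ⟩
  exact le_antisymm (measure_le_of_relaxedW_eq_zero hα hβ h hF)
    (measure_le_of_relaxedW_eq_zero hα hβ (relaxedW_comm μ ν ▸ h) hF)

end Separation

section Signed

variable {X : Type*} [MeasurableSpace X]

theorem toSignedMeasure_sub_eq_sub_iff {μ₁ μ₂ ν₁ ν₂ : Measure X} [IsFiniteMeasure μ₁]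
    [IsFiniteMeasure μ₂] [IsFiniteMeasure ν₁] [IsFiniteMeasure ν₂] :
    μ₁.toSignedMeasure - μ₂.toSignedMeasure = ν₁.toSignedMeasure - ν₂.toSignedMeasure ↔
      μ₁ + ν₂ = ν₁ + μ₂ := by
  rw [sub_eq_sub_iff_add_eq_add, ← Measure.toSignedMeasure_add, ← Measure.toSignedMeasure_add,
    Measure.toSignedMeasure_eq_toSignedMeasure_iff]

theorem toJordanDecomposition_posPart_add_eq_add_iff {μ ν : SignedMeasure X} :
    μ.toJordanDecomposition.posPart + ν.toJordanDecomposition.negPart =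
      ν.toJordanDecomposition.posPart + μ.toJordanDecomposition.negPart ↔ μ = ν := by
  rw [← toSignedMeasure_sub_eq_sub_iff]
  exact iff_of_eq (congrArg₂ _ μ.toSignedMeasure_toJordanDecomposition
    ν.toSignedMeasure_toJordanDecomposition)

variable [PseudoEMetricSpace X] {α β : ℝ≥0}

/-- The generalized Wasserstein distance between signed measures on an arbitrary space, computed
with the Jordan decompositions. -/
noncomputable def signedRelaxedW (α β : ℝ≥0) (μ ν : SignedMeasure X) : ℝ≥0∞ :=
  relaxedW α β (μ.toJordanDecomposition.posPart + ν.toJordanDecomposition.negPart)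
    (μ.toJordanDecomposition.negPart + ν.toJordanDecomposition.posPart)

theorem signedRelaxedW_eq_zero_iff [BorelSpace X] [SecondCountableTopology X] (hα : 0 < α)
    (hβ : 0 < β) {μ ν : SignedMeasure X} : signedRelaxedW α β μ ν = 0 ↔ μ = ν := by
  rw [signedRelaxedW, relaxedW_eq_zero_iff hα hβ,
    add_comm μ.toJordanDecomposition.negPart, toJordanDecomposition_posPart_add_eq_add_iff]

variable [OpensMeasurableSpace X] [SecondCountableTopology X]

theorem signedRelaxedW_comm (μ ν : SignedMeasure X) :
    signedRelaxedW α β μ ν = signedRelaxedW α β ν μ := by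
  rw [signedRelaxedW, signedRelaxedW, relaxedW_comm, add_comm μ.toJordanDecomposition.negPart,
    add_comm μ.toJordanDecomposition.posPart]

variable [StandardBorelSpace X] [Nonempty X]

theorem relaxedW_eq_relaxedW_of_add_eq_add {μ₁ ν₁ μ₂ ν₂ : Measure X} [IsFiniteMeasure μ₁]
    [IsFiniteMeasure ν₁] [IsFiniteMeasure μ₂] [IsFiniteMeasure ν₂] (h : μ₁ + ν₂ = μ₂ + ν₁) :
    relaxedW α β μ₁ ν₁ = relaxedW α β μ₂ ν₂ := by
  rw [← relaxedW_add_right μ₁ ν₁ ν₂, h, add_comm ν₁ ν₂, relaxedW_add_right]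

theorem relaxedW_eq_signedRelaxedW (μp μm νp νm : Measure X) [IsFiniteMeasure μp]
    [IsFiniteMeasure μm] [IsFiniteMeasure νp] [IsFiniteMeasure νm] :
    relaxedW α β (μp + νm) (μm + νp) =
      signedRelaxedW α β (μp.toSignedMeasure - μm.toSignedMeasure)
        (νp.toSignedMeasure - νm.toSignedMeasure) := by
  have add_eq_add (θ₁ θ₂ : Measure X) [IsFiniteMeasure θ₁] [IsFiniteMeasure θ₂] :
      (θ₁.toSignedMeasure - θ₂.toSignedMeasure).toJordanDecomposition.posPart + θ₂ =
        θ₁ + (θ₁.toSignedMeasure - θ₂.toSignedMeasure).toJordanDecomposition.negPart :=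
    toSignedMeasure_sub_eq_sub_iff.1 (SignedMeasure.toSignedMeasure_toJordanDecomposition _)
  refine relaxedW_eq_relaxedW_of_add_eq_add ?_
  rw [add_add_add_comm, ← add_eq_add μp μm, add_comm νm, add_eq_add νp νm]
  abel

theorem signedRelaxedW_triangle (μ ν η : SignedMeasure X) :
    signedRelaxedW α β μ η ≤ signedRelaxedW α β μ ν + signedRelaxedW α β ν η := by
  rw [signedRelaxedW,
    ← relaxedW_add_right _ _ (ν.toJordanDecomposition.posPart + ν.toJordanDecomposition.negPart)]
  refine le_of_eq_of_le ?_ (relaxedW_add_le _ _ _ _)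
  congr 1 <;> abel

end Signed

section Euclidean

variable {d : ℕ} {a b : ℝ}

theorem signedMass_diff (μ ν : FiniteMeasure (Rd d)) :
    signedMass (diff μ ν) = tvDist (μ : Measure (Rd d)) ν := by
  rw [signedMass, diff, SignedMeasure.totalVariation,
    Measure.toJordanDecomposition_toSignedMeasure_sub]
  rfl

theorem mem_transferencePlans_iff {μ ν : FiniteMeasure (Rd d)} {π : Measure (Rd d × Rd d)} :
    π ∈ transferencePlans μ ν ↔ π.fst = μ ∧ π.snd = ν := by
  simp only [transferencePlans, Set.mem_ofPred_eq, Measure.ext_iff, Set.prod_univ, Set.univ_prod]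
  exact and_congr (forall₂_congr fun A hA => by rw [Measure.fst_apply hA])
    (forall₂_congr fun B hB => by rw [Measure.snd_apply hB])

theorem W₁_eq_iInf_transportCost (μ ν : FiniteMeasure (Rd d)) :
    W₁ μ ν = ⨅ π ∈ transferencePlans μ ν, transportCost π := by
  simp only [W₁, transportCost, edist_dist, dist_eq_norm]

theorem genW_le_relaxedCost (μ ν : FiniteMeasure (Rd d)) (π : Measure (Rd d × Rd d))
    [IsFiniteMeasure π] :
    genW a b μ ν ≤ relaxedCost a.toNNReal b.toNNReal (μ : Measure (Rd d)) ν π := by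
  let μ' : FiniteMeasure (Rd d) := ⟨π.fst, inferInstance⟩
  let ν' : FiniteMeasure (Rd d) := ⟨π.snd, inferInstance⟩
  have hmass : μ'.mass = ν'.mass := by
    rw [← ENNReal.coe_inj, FiniteMeasure.ennreal_mass, FiniteMeasure.ennreal_mass]
    exact Measure.fst_univ.trans Measure.snd_univ.symm
  have hW₁ : W₁ μ' ν' ≤ transportCost π := by
    rw [W₁_eq_iInf_transportCost]
    exact iInf₂_le π (mem_transferencePlans_iff.2 ⟨rfl, rfl⟩)
  calc genW a b μ ν
      ≤ ENNReal.ofReal a * (signedMass (diff μ μ') + signedMass (diff ν ν')) +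
          ENNReal.ofReal b * W₁ μ' ν' := iInf_le_of_le μ' <| iInf_le_of_le ν' <| iInf_le _ hmass
    _ ≤ relaxedCost a.toNNReal b.toNNReal (μ : Measure (Rd d)) ν π := by
        rw [signedMass_diff, signedMass_diff]
        exact add_le_add le_rfl (by gcongr; rfl)

theorem relaxedW_le_of_mem_transferencePlans (μ ν : FiniteMeasure (Rd d))
    {μ' ν' : FiniteMeasure (Rd d)} {π : Measure (Rd d × Rd d)} (hπ : π ∈ transferencePlans μ' ν') :
    relaxedW a.toNNReal b.toNNReal (μ : Measure (Rd d)) ν ≤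
      ENNReal.ofReal a * (signedMass (diff μ μ') + signedMass (diff ν ν')) +
        ENNReal.ofReal b * transportCost π := by
  obtain ⟨hfst, hsnd⟩ := mem_transferencePlans_iff.1 hπ
  have : IsFiniteMeasure π := ⟨by rw [← Measure.fst_univ, hfst]; exact measure_lt_top _ _⟩
  rw [signedMass_diff, signedMass_diff, ← hfst, ← hsnd]
  exact relaxedW_le_relaxedCost _ _ π

theorem genW_eq_relaxedW (hb : 0 < b) (μ ν : FiniteMeasure (Rd d)) :
    genW a b μ ν = relaxedW a.toNNReal b.toNNReal (μ : Measure (Rd d)) ν := by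
  have hb₀ : ENNReal.ofReal b ≠ 0 := by simpa using hb
  refine le_antisymm (le_iInf fun π => genW_le_relaxedCost μ ν π)
    (le_iInf fun μ' => le_iInf fun ν' => le_iInf fun _ => ?_)
  simp only [W₁_eq_iInf_transportCost, ENNReal.mul_iInf_of_ne hb₀ ENNReal.ofReal_ne_top,
    ENNReal.add_iInf]
  exact le_iInf₂ fun π hπ => relaxedW_le_of_mem_transferencePlans μ ν hπ

theorem signedW_eq_signedRelaxedW (hb : 0 < b) (μ ν : SignedMeasure (Rd d)) :
    signedW a b μ ν = signedRelaxedW a.toNNReal b.toNNReal μ ν := by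
  rw [signedW, genW_eq_relaxedW hb]
  rfl

end Euclidean

end SignedWasserstein

open SignedWasserstein in
theorem proposition17_general {X : Type*} [MeasurableSpace X] [PseudoEMetricSpace X] [BorelSpace X]
    [SecondCountableTopology X] [StandardBorelSpace X] [Nonempty X] {α β : ℝ≥0} (hα : 0 < α)
    (hβ : 0 < β) :
    (∀ (μp μm νp νm : Measure X) [IsFiniteMeasure μp] [IsFiniteMeasure μm] [IsFiniteMeasure νp]
      [IsFiniteMeasure νm], relaxedW α β (μp + νm) (μm + νp) =
        signedRelaxedW α β (μp.toSignedMeasure - μm.toSignedMeasure)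
          (νp.toSignedMeasure - νm.toSignedMeasure)) ∧
    (∀ μ ν : SignedMeasure X, signedRelaxedW α β μ ν ≠ ∞) ∧
    (∀ μ ν : SignedMeasure X, signedRelaxedW α β μ ν = 0 ↔ μ = ν) ∧
    (∀ μ ν : SignedMeasure X, signedRelaxedW α β μ ν = signedRelaxedW α β ν μ) ∧
    (∀ μ ν η : SignedMeasure X,
      signedRelaxedW α β μ η ≤ signedRelaxedW α β μ ν + signedRelaxedW α β ν η) :=
  ⟨fun μp μm νp νm => relaxedW_eq_signedRelaxedW μp μm νp νm, fun _ _ => relaxedW_ne_top _ _,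
    fun _ _ => signedRelaxedW_eq_zero_iff hα hβ, signedRelaxedW_comm, signedRelaxedW_triangle⟩

theorem proposition17 (d : ℕ) (a b : ℝ) (ha : 0 < a) (hb : 0 < b) :
    -- the value does not depend on the decompositions
    (∀ (μ ν : SignedMeasure (SignedWasserstein.Rd d))
      (μp μm νp νm : FiniteMeasure (SignedWasserstein.Rd d)),
      μ = SignedWasserstein.diff μp μm → ν = SignedWasserstein.diff νp νm →
        SignedWasserstein.genW a b (μp + νm) (μm + νp) = SignedWasserstein.signedW a b μ ν) ∧
    -- it is finite, and it is a distance
    (∀ μ ν : SignedMeasure (SignedWasserstein.Rd d), SignedWasserstein.signedW a b μ ν ≠ ∞) ∧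
    (∀ μ ν : SignedMeasure (SignedWasserstein.Rd d),
      SignedWasserstein.signedW a b μ ν = 0 ↔ μ = ν) ∧
    (∀ μ ν : SignedMeasure (SignedWasserstein.Rd d),
      SignedWasserstein.signedW a b μ ν = SignedWasserstein.signedW a b ν μ) ∧
    (∀ μ ν η : SignedMeasure (SignedWasserstein.Rd d),
      SignedWasserstein.signedW a b μ η ≤
        SignedWasserstein.signedW a b μ ν + SignedWasserstein.signedW a b ν η) := by
  simp only [SignedWasserstein.signedW_eq_signedRelaxedW hb, SignedWasserstein.genW_eq_relaxedW hb]
  obtain ⟨hwell, hdist⟩ := proposition17_general (X := SignedWasserstein.Rd d)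
    (Real.toNNReal_pos.2 ha) (Real.toNNReal_pos.2 hb)
  exact ⟨fun _ _ μp μm νp νm hμ hν => by subst hμ hν; exact hwell μp μm νp νm, hdist⟩
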